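/- Let $n,d\ge 1$ and $s$ be integers with $s>\frac d2$, let $X\subset\mathbb R^n$ be nonempty, let $\mathbb T^d=(\mathbb R/\mathbb Z)^d$ carry the measure induced by Lebesgue measure, and let $f:X\times\mathbb T^d\to\mathbb R$ be such that for each $x\in X$ the function $f(x,\cdot)$ is $s$ times continuously differentiable on $\mathbb T^d$. Suppose that $$B:=\sup_{x\in X}\|f(x,\cdot)\|_{L^2(\mathbb T^d)}<+\infty,\qquad C:=\sup_{x\in X}\sum_{i=1}^d\Big\|\frac{\partial^s f(x,\cdot)}{\partial\xi_i^s}\Big\|_{L^2(\mathbb T^d)}<+\infty .$$ For $\varepsilon>0$ put $$D(\varepsilon):=\left(2\left\lceil\left(\frac{12\sqrt2\,C\,2^d}{(2\pi)^s\,\varepsilon}\right)^{\frac{2}{2s-d}}\right\rceil+1\right)^d .$$ Let $\mathcal F=\{f(x,\cdot):x\in X\}\subset C(\mathbb T^d)$, and let $\mathcal N(\mathcal F,\delta)$ be the smallest cardinality of a set $\mathcal F'\subset\mathcal F$ such that every $g\in\mathcal F$ satisfies $\sup_{\xi\in\mathbb T^d}|g(\xi)-g'(\xi)|\le\delta$ for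 some $g'\in\mathcal F'$. Then for every $\varepsilon>0$ the number $\mathcal N(\mathcal F,\frac\varepsilon4)$ is finite and $$\mathcal N\Big(\mathcal F,\frac{\varepsilon}{4}\Big)\le\max\left\{1,\ \frac1{D(\varepsilon)}\left(\frac{\pi D(\varepsilon)^2}{2}\right)^{D(\varepsilon)}\left(\frac{24B}{\varepsilon}\right)^{2D(\varepsilon)}\right\}.$$ -/

import Mathlib

open Set MeasureTheory
open scoped ENNReal

noncomputable section

/-- A real function on the torus `(ℝ/ℤ)^d` is `s` times continuously differentiable: its pullback
along the covering map `ℝ^d → (ℝ/ℤ)^d` is of class `C^s`. -/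
def TorusContDiff {d : ℕ} (s : ℕ) (g : UnitAddTorus (Fin d) → ℝ) : Prop :=
  ContDiff ℝ s (fun y : Fin d → ℝ => g (fun i => (y i : UnitAddCircle)))

/-- The pure partial derivative `∂^s g / ∂ξ_i^s` of a function on the torus: the `s`-th derivative
at `t = 0` of `t ↦ g (ξ + t e_i)`. -/
def torusPartialDeriv {d : ℕ} (i : Fin d) (s : ℕ) (g : UnitAddTorus (Fin d) → ℝ) :
    UnitAddTorus (Fin d) → ℝ :=
  fun ξ => iteratedDeriv s
    (fun t : ℝ => g (ξ + (Pi.single i (t : UnitAddCircle) : UnitAddTorus (Fin d)))) 0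

/-- The `L²` norm on the torus, with respect to the measure induced by Lebesgue measure
(of total mass one). It is used for continuous functions only. -/
def torusL2Norm {d : ℕ} (g : UnitAddTorus (Fin d) → ℝ) : ℝ :=
  Real.sqrt (∫ ξ, g ξ ^ 2)

/-- The family `{f(x, ·) : x ∈ X}`, as a subset of the space of continuous real functions on the
torus; the metric of `C(UnitAddTorus (Fin d), ℝ)` is the supremum metric. -/
def functionFamily {ι : Type*} {d : ℕ} (f : ι → UnitAddTorus (Fin d) → ℝ) :
    Set C(UnitAddTorus (Fin d), ℝ) :=
  {g | ∃ x, ⇑g = f x}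

/-- The cut-off frequency `⌈(12 √2 C 2^d / ((2π)^s ε))^(2 / (2s - d))⌉`. -/
def cutoffFrequency (d s : ℕ) (C ε : ℝ) : ℕ :=
  ⌈(12 * Real.sqrt 2 * C * 2 ^ d / ((2 * Real.pi) ^ s * ε)) ^ (2 / (2 * (s : ℝ) - d))⌉₊

/-- The number `D(ε)` of integer frequencies `k` with `|k|_∞` at most the cut-off frequency. -/
def frequencyCount (d s : ℕ) (C ε : ℝ) : ℕ :=
  (2 * cutoffFrequency d s C ε + 1) ^ d

end

/-! A maximal `ε/4`-separated subset of the family is an `ε/4`-net, so it suffices to bound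
separated sets. Integration by parts and Parseval bound the coefficients weighted by `|k|^s` in `ℓ²`
by `C / (2π)^s`. Cauchy–Schwarz and a sum over cubic shells, convergent because `2s > d`, then give
an `ℓ¹` tail of at most `ε/12` beyond the cut-off (`TorusContDiff.sum_norm_torusFourierCoeff_le`).
The remaining `D` coefficients of a real function are encoded isometrically by `D` real numbers,
forming a vector of norm at most `B`. By `abs_sub_le_of_hartleyVector`, `ε/4`-separated functions
have vectors at distance at least `ε / (12 √D)`. Comparing volumes of balls in `ℝ^D` gives at most
`(1 + 24 B √D / ε)^D` of them, which lies below the stated bound when `D ≥ 2`. The case `C = 0`,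
where `D = 1`, uses that the tail vanishes. -/

/-! ### Volume packing and numerical comparisons. -/

/-- Volumetric packing bound: an `r`-separated set in a ball of radius `R` has at most
`(1 + 2R/r)^dim` elements. -/
theorem card_le_of_pairwise_le_norm_sub {E : Type*} [NormedAddCommGroup E] [NormedSpace ℝ E]
    [FiniteDimensional ℝ E] (s : Finset E) {R r : ℝ} (hR : 0 ≤ R) (hr : 0 < r)
    (hs : ∀ c ∈ s, ‖c‖ ≤ R) (h : ∀ c ∈ s, ∀ d ∈ s, c ≠ d → r ≤ ‖c - d‖) :
    (s.card : ℝ) ≤ (1 + 2 * R / r) ^ Module.finrank ℝ E := by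
  borelize E
  let μ : Measure E := Measure.addHaar
  have hδ : 0 < r / 2 := by positivity
  have hρ : 0 < R + r / 2 := by positivity
  set A := ⋃ c ∈ s, Metric.ball (c : E) (r / 2) with hA
  have D : Set.Pairwise (s : Set E) (Function.onFun Disjoint fun c => Metric.ball (c : E) (r / 2)) := by
    rintro c hc d hd hcd
    apply Metric.ball_disjoint_ball
    rw [dist_eq_norm]
    linarith [h c hc d hd hcd]
  have A_subset : A ⊆ Metric.ball (0 : E) (R + r / 2) := by
    refine iUnion₂_subset fun x hx => ?_
    apply Metric.ball_subset_ball'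
    rw [dist_zero_right]
    linarith [hs x hx]
  have I : (s.card : ℝ≥0∞) * ENNReal.ofReal ((r / 2) ^ Module.finrank ℝ E) * μ (Metric.ball 0 1) ≤
      ENNReal.ofReal ((R + r / 2) ^ Module.finrank ℝ E) * μ (Metric.ball 0 1) :=
    calc
      _ = μ A := by
        rw [hA, measure_biUnion_finset D fun c _ => measurableSet_ball]
        simp only [μ.addHaar_ball_of_pos _ hδ]
        simp only [Finset.sum_const, nsmul_eq_mul, mul_assoc]
      _ ≤ μ (Metric.ball (0 : E) (R + r / 2)) := measure_mono A_subset
      _ = _ := by simp only [μ.addHaar_ball_of_pos _ hρ]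
  have J := (ENNReal.mul_le_mul_iff_left (Metric.measure_ball_pos _ _ zero_lt_one).ne'
    measure_ball_lt_top.ne).1 I
  have K := ENNReal.toReal_le_of_le_ofReal (pow_nonneg hρ.le _) J
  rw [ENNReal.toReal_mul, ENNReal.toReal_natCast, ENNReal.toReal_ofReal (by positivity)] at K
  rw [← le_div_iff₀ (by positivity), ← div_pow] at K
  refine K.trans_eq ?_
  congr 1
  field_simp
  ring

/-- The packing bound in dimension one is dominated by the quadratic bound. -/
theorem one_add_div_le_pi_mul_sq {y : ℝ} (hy : 3 ≤ y) :
    1 + y / 3 ≤ Real.pi / 2 * y ^ 2 := by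
  nlinarith [Real.pi_gt_three]

/-- The packing bound in dimension at least two is dominated by the stated bound. -/
theorem one_add_mul_sqrt_pow_le {D : ℕ} (hD : 2 ≤ D) {y : ℝ}
    (hy : 1 ≤ y * Real.sqrt D) :
    (1 + y * Real.sqrt D) ^ D ≤
      1 / (D : ℝ) * (Real.pi * (D : ℝ) ^ 2 / 2) ^ D * y ^ (2 * D) := by
  have hD' : (2 : ℝ) ≤ D := by exact_mod_cast hD
  set q := Real.sqrt D with hq
  have hqq : q ^ 2 = D := Real.sq_sqrt (by positivity)
  have hq0 : 0 < q := Real.sqrt_pos.mpr (by linarith)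
  have hq1 : 1.4 ≤ q := by
    apply Real.le_sqrt_of_sq_le
    linarith
  have hy0 : 0 < y := pos_of_mul_pos_left (by linarith) hq0.le
  -- One factor `q` for each dimension pays for the prefactor `1 / D`.
  have h1 : (D : ℝ) ≤ q ^ D := by
    rw [← hqq]
    exact pow_le_pow_right₀ (by linarith) hD
  have h2 : 2 * (y * q) * q ≤ Real.pi * (D : ℝ) ^ 2 / 2 * y ^ 2 := by
    rw [← hqq]
    have h3 : 4 ≤ Real.pi * q * (y * q) := by
      have : 4 ≤ Real.pi * q := by nlinarith [Real.pi_gt_three]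
      nlinarith
    have h4 : 0 ≤ (y * q) * q := by positivity
    nlinarith
  rw [mul_assoc, one_div, inv_mul_eq_div, le_div_iff₀ (by linarith), pow_mul, ← mul_pow]
  calc (1 + y * q) ^ D * D ≤ (2 * (y * q)) ^ D * q ^ D := by
        gcongr
        linarith
    _ = (2 * (y * q) * q) ^ D := by rw [← mul_pow]
    _ ≤ _ := by gcongr

/-! ### Lattice sums over frequency shells. -/

/-- The integer frequencies `k` with `|k|_∞ ≤ N`. -/
noncomputable def frequencyCube (d N : ℕ) : Finset (Fin d → ℤ) :=
  Fintype.piFinset fun _ => Finset.Icc (-(N : ℤ)) N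

/-- The maximum norm of an integer frequency. -/
def frequencyNorm {d : ℕ} (k : Fin d → ℤ) : ℕ :=
  Finset.univ.sup fun i => (k i).natAbs

theorem mem_frequencyCube {d N : ℕ} {k : Fin d → ℤ} :
    k ∈ frequencyCube d N ↔ frequencyNorm k ≤ N := by
  simp only [frequencyCube, frequencyNorm, Fintype.mem_piFinset, Finset.mem_Icc, Finset.sup_le_iff,
    Finset.mem_univ, true_imp_iff]
  exact forall_congr' fun i => by omega

theorem card_frequencyCube (d N : ℕ) : (frequencyCube d N).card = (2 * N + 1) ^ d := by
  simp only [frequencyCube, Fintype.card_piFinset, Int.card_Icc, Finset.prod_const,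
    Finset.card_univ, Fintype.card_fin]
  congr 1
  omega

theorem frequencyCube_mono (d : ℕ) {M N : ℕ} (h : M ≤ N) :
    frequencyCube d M ⊆ frequencyCube d N := fun _ hk =>
  mem_frequencyCube.2 ((mem_frequencyCube.1 hk).trans h)

theorem neg_mem_frequencyCube {d N : ℕ} {k : Fin d → ℤ} (hk : k ∈ frequencyCube d N) :
    -k ∈ frequencyCube d N := by
  simpa [mem_frequencyCube, frequencyNorm] using mem_frequencyCube.1 hk

theorem frequencyNorm_pow_le {d : ℕ} (k : Fin d → ℤ) {n : ℕ} (hn : n ≠ 0) :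
    ((frequencyNorm k : ℝ)) ^ n ≤ ∑ i, |(k i : ℝ)| ^ n := by
  rcases isEmpty_or_nonempty (Fin d) with h | h
  · simp [frequencyNorm, hn]
  obtain ⟨i, -, hi⟩ := Finset.exists_mem_eq_sup Finset.univ Finset.univ_nonempty
    fun i => (k i).natAbs
  have : (frequencyNorm k : ℝ) = |(k i : ℝ)| := by
    rw [frequencyNorm, hi, Nat.cast_natAbs, Int.cast_abs]
  rw [this]
  exact Finset.single_le_sum (f := fun i => |(k i : ℝ)| ^ n) (fun i _ => by positivity)
    (Finset.mem_univ i)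

/-- A difference of `d`-th powers is at most `2 d (2M+3)^(d-1)`, and `d 3^(d-1) ≤ 4^d`. Writing
`(M+1)^d / (M+1)` avoids the exponent `d - 1`, so `d = 0` is covered. -/
theorem card_shell_le (d M : ℕ) :
    (2 * (M + 1 : ℝ) + 1) ^ d - (2 * (M : ℝ) + 1) ^ d ≤
      2 * 4 ^ d * (M + 1 : ℝ) ^ d * (1 / (M + 1)) := by
  rcases d with _ | e
  · simp
    positivity
  have hb : ∀ e : ℕ, ((2 * (M + 1 : ℝ) + 1) ^ (e + 1) - (2 * (M : ℝ) + 1) ^ (e + 1)) ≤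
      2 * (e + 1) * (2 * (M + 1 : ℝ) + 1) ^ e := by
    intro e
    induction e with
    | zero => simp; linarith
    | succ e ih =>
      rw [pow_succ _ (e + 1), pow_succ (2 * (M : ℝ) + 1) (e + 1)]
      have h1 : (2 * (M : ℝ) + 1) ^ (e + 1) ≤ (2 * (M + 1 : ℝ) + 1) ^ (e + 1) := by
        gcongr
        linarith
      have h2 : ((2 * (M + 1 : ℝ) + 1) ^ (e + 1) - (2 * (M : ℝ) + 1) ^ (e + 1)) *
          (2 * (M : ℝ) + 1) ≤ 2 * (e + 1) * (2 * (M + 1 : ℝ) + 1) ^ e * (2 * (M + 1 : ℝ) + 1) := by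
        gcongr
        · linarith
      rw [mul_assoc, ← pow_succ] at h2
      push_cast
      nlinarith
  have h3 : ((e : ℝ) + 1) * 3 ^ e ≤ 4 ^ (e + 1) := by
    induction e with
    | zero => norm_num
    | succ e ih =>
      have : (3 : ℝ) ^ (e + 1) ≤ 4 ^ (e + 1) := by gcongr; norm_num
      rw [pow_succ (4 : ℝ) (e + 1)]
      push_cast
      rw [pow_succ] at this ⊢
      nlinarith
  calc _ ≤ 2 * ((e : ℝ) + 1) * (2 * (M + 1 : ℝ) + 1) ^ e := hb e
    _ ≤ 2 * ((e : ℝ) + 1) * (3 * (M + 1 : ℝ)) ^ e := by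
        gcongr
        linarith [(Nat.cast_nonneg M : (0 : ℝ) ≤ M)]
    _ = 2 * (((e : ℝ) + 1) * 3 ^ e) * (M + 1 : ℝ) ^ e := by rw [mul_pow]; ring
    _ ≤ 2 * 4 ^ (e + 1) * (M + 1 : ℝ) ^ e := by gcongr
    _ = _ := by field_simp; ring

/-- Makes the shell sum telescope; it follows from `(1 + 1/M)^p ≥ 1 + 1/(M+1)`. -/
theorem one_div_pow_sub_le {M p : ℕ} (hM : 1 ≤ M) (hp : 1 ≤ p) :
    1 / (M + 1 : ℝ) ^ p * (1 / (M + 1)) ≤ 1 / (M : ℝ) ^ p - 1 / (M + 1 : ℝ) ^ p := by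
  have hM0 : (0 : ℝ) < M := by exact_mod_cast hM
  have h1 : 1 + 1 / (M + 1 : ℝ) ≤ ((M + 1) / M : ℝ) ^ p := by
    calc 1 + 1 / (M + 1 : ℝ) ≤ 1 + 1 / M := by gcongr; linarith
      _ = ((M + 1) / M : ℝ) ^ 1 := by field_simp
      _ ≤ _ := by
        gcongr
        rw [le_div_iff₀ hM0]
        linarith
  have h2 : 1 / (M : ℝ) ^ p = 1 / (M + 1 : ℝ) ^ p * ((M + 1) / M : ℝ) ^ p := by
    rw [div_pow]
    field_simp
  rw [h2, le_sub_iff_add_le]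
  have : 0 ≤ 1 / (M + 1 : ℝ) ^ p := by positivity
  nlinarith

/-- A lattice sum over the complement of a cube, bounded by summation over shells. -/
theorem sum_frequencyNorm_pow_inv_le {d p n N M : ℕ} (hN : 1 ≤ N) (hNM : N ≤ M) (hp : 1 ≤ p)
    (hn : n = d + p) :
    ∑ k ∈ frequencyCube d M \ frequencyCube d N, ((frequencyNorm k : ℝ) ^ n)⁻¹ ≤
      2 * 4 ^ d * (1 / (N : ℝ) ^ p - 1 / (M : ℝ) ^ p) := by
  -- The subtracted term `1 / M^p` in the claim is what lets the induction close.
  induction M, hNM using Nat.le_induction with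
  | base => simp
  | succ M hNM ih =>
    have hsplit : frequencyCube d (M + 1) \ frequencyCube d N =
        (frequencyCube d M \ frequencyCube d N) ∪
          (frequencyCube d (M + 1) \ frequencyCube d M) := by
      ext k
      simp only [Finset.mem_union, Finset.mem_sdiff, mem_frequencyCube]
      omega
    have hdisj : Disjoint (frequencyCube d M \ frequencyCube d N)
        (frequencyCube d (M + 1) \ frequencyCube d M) := by
      rw [Finset.disjoint_left]
      intro k
      simp only [Finset.mem_sdiff, mem_frequencyCube]
      omega
    rw [hsplit, Finset.sum_union hdisj]
    have hshell : ∑ k ∈ frequencyCube d (M + 1) \ frequencyCube d M,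
        ((frequencyNorm k : ℝ) ^ n)⁻¹ =
        ((2 * (M + 1 : ℝ) + 1) ^ d - (2 * (M : ℝ) + 1) ^ d) * ((M + 1 : ℝ) ^ n)⁻¹ := by
      rw [Finset.sum_congr rfl (g := fun _ => ((M + 1 : ℝ) ^ n)⁻¹), Finset.sum_const,
        nsmul_eq_mul, Finset.cast_card_sdiff (frequencyCube_mono d M.le_succ), card_frequencyCube,
        card_frequencyCube]
      · push_cast
        rfl
      · intro k hk
        simp only [Finset.mem_sdiff, mem_frequencyCube] at hk
        have : frequencyNorm k = M + 1 := by omega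
        rw [this]
        push_cast
        rfl
    have hM : 1 ≤ M := hN.trans hNM
    calc _ ≤ 2 * 4 ^ d * (1 / (N : ℝ) ^ p - 1 / (M : ℝ) ^ p) +
          2 * 4 ^ d * (M + 1 : ℝ) ^ d * (1 / (M + 1)) * ((M + 1 : ℝ) ^ n)⁻¹ := by
          rw [hshell]
          gcongr
          exact card_shell_le d M
      _ = 2 * 4 ^ d * (1 / (N : ℝ) ^ p - 1 / (M : ℝ) ^ p +
          1 / (M + 1 : ℝ) ^ p * (1 / (M + 1))) := by
          rw [hn, pow_add]
          field_simp
      _ ≤ _ := by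
          have := one_div_pow_sub_le hM hp
          push_cast
          gcongr
          linarith

/-! ### Fourier coefficients on the torus. -/

theorem volume_unitAddCircle_eq_haar :
    (volume : Measure UnitAddCircle) = AddCircle.haarAddCircle := by
  rw [AddCircle.volume_eq_smul_haarAddCircle]
  simp

theorem volume_unitAddTorus_eq_pi_haar (d : ℕ) :
    (volume : Measure (UnitAddTorus (Fin d))) =
      Measure.pi fun _ => (AddCircle.haarAddCircle : Measure UnitAddCircle) := by
  rw [volume_pi, volume_unitAddCircle_eq_haar]

instance {d : ℕ} : IsProbabilityMeasure (volume : Measure (UnitAddTorus (Fin d))) := by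
  rw [volume_unitAddTorus_eq_pi_haar]
  infer_instance

/-- The Fourier coefficients of a real function on the torus. -/
noncomputable def torusFourierCoeff {d : ℕ} (g : UnitAddTorus (Fin d) → ℝ) (k : Fin d → ℤ) : ℂ :=
  ∫ ξ, UnitAddTorus.mFourier (-k) ξ * (g ξ : ℂ)

theorem mFourierCoeff_ofReal {d : ℕ} (g : UnitAddTorus (Fin d) → ℝ) (k : Fin d → ℤ) :
    UnitAddTorus.mFourierCoeff (fun ξ => (g ξ : ℂ)) k = torusFourierCoeff g k := by
  rw [UnitAddTorus.mFourierCoeff, torusFourierCoeff, volume_unitAddTorus_eq_pi_haar]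
  rfl

theorem hasSum_sq_torusFourierCoeff {d : ℕ} {g : UnitAddTorus (Fin d) → ℝ} (hg : Continuous g) :
    HasSum (fun k => ‖torusFourierCoeff g k‖ ^ 2) (torusL2Norm g ^ 2) := by
  let G : C(UnitAddTorus (Fin d), ℂ) := ⟨fun ξ => (g ξ : ℂ), by fun_prop⟩
  let μ : Measure (UnitAddTorus (Fin d)) :=
    Measure.pi fun _ => (AddCircle.haarAddCircle : Measure UnitAddCircle)
  have h := UnitAddTorus.hasSum_sq_mFourierCoeff (d := Fin d) (ContinuousMap.toLp 2 μ ℂ G)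
  have h1 : ∀ k, UnitAddTorus.mFourierCoeff (ContinuousMap.toLp 2 μ ℂ G) k =
      torusFourierCoeff g k :=
    fun k => (UnitAddTorus.mFourierCoeff_toLp G k).trans (mFourierCoeff_ofReal g k)
  simp only [h1] at h
  convert h using 1
  rw [torusL2Norm, Real.sq_sqrt (integral_nonneg fun _ => sq_nonneg _),
    volume_unitAddTorus_eq_pi_haar]
  refine integral_congr_ae ?_
  filter_upwards [ContinuousMap.coeFn_toLp (p := 2) (𝕜 := ℂ) μ G] with ξ hξ
  rw [hξ]
  simp [G]

theorem hasSum_torusFourierCoeff_mul {d : ℕ} {g : UnitAddTorus (Fin d) → ℝ} (hg : Continuous g)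
    (hs : Summable fun k => ‖torusFourierCoeff g k‖) (ξ : UnitAddTorus (Fin d)) :
    HasSum (fun k => torusFourierCoeff g k * UnitAddTorus.mFourier k ξ) (g ξ : ℂ) := by
  let G : C(UnitAddTorus (Fin d), ℂ) := ⟨fun ξ => (g ξ : ℂ), by fun_prop⟩
  have h1 : UnitAddTorus.mFourierCoeff G = torusFourierCoeff g :=
    funext fun k => mFourierCoeff_ofReal g k
  have := UnitAddTorus.hasSum_mFourier_series_apply_of_summable (f := G)
    (by rw [h1]; exact hs.of_norm) ξ
  rwa [h1] at this

theorem torusFourierCoeff_sub {d : ℕ} {g h : UnitAddTorus (Fin d) → ℝ} (hg : Continuous g)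
    (hh : Continuous h) (k : Fin d → ℤ) :
    torusFourierCoeff (g - h) k = torusFourierCoeff g k - torusFourierCoeff h k := by
  rw [torusFourierCoeff, torusFourierCoeff, torusFourierCoeff, ← integral_sub]
  · congr 1 with ξ
    simp [mul_sub]
  · exact Continuous.integrable_of_hasCompactSupport (by fun_prop)
      (HasCompactSupport.of_compactSpace _)
  · exact Continuous.integrable_of_hasCompactSupport (by fun_prop)
      (HasCompactSupport.of_compactSpace _)

theorem torusFourierCoeff_neg {d : ℕ} (g : UnitAddTorus (Fin d) → ℝ) (k : Fin d → ℤ) :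
    torusFourierCoeff g (-k) = starRingEnd ℂ (torusFourierCoeff g k) := by
  rw [torusFourierCoeff, torusFourierCoeff, ← integral_conj]
  congr 1 with ξ
  rw [map_mul, ← UnitAddTorus.mFourier_neg, Complex.conj_ofReal]

/-! ### Fourier coefficients of partial derivatives. -/

theorem mFourier_add_arg {d : ℕ} (k : Fin d → ℤ) (ξ η : UnitAddTorus (Fin d)) :
    UnitAddTorus.mFourier k (ξ + η) = UnitAddTorus.mFourier k ξ * UnitAddTorus.mFourier k η := by
  simp [UnitAddTorus.mFourier, Finset.prod_mul_distrib, fourier_apply, AddCircle.toCircle_add]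

theorem mFourier_single_arg {d : ℕ} (k : Fin d → ℤ) (i : Fin d) (t : UnitAddCircle) :
    UnitAddTorus.mFourier k (Pi.single i t) = fourier (k i) t := by
  rw [UnitAddTorus.mFourier, ContinuousMap.coe_mk, Finset.prod_eq_single i]
  · simp
  · intro j _ hj
    simp [Pi.single_eq_of_ne hj]
  · simp

/-- The integral of a continuous function over the torus is the integral of its averages along
the circles in direction `i`. -/
theorem integral_torus_eq_integral_intervalIntegral {d : ℕ} {F : UnitAddTorus (Fin d) → ℂ}
    (hF : Continuous F) (i : Fin d) :
    ∫ ξ, F ξ = ∫ ξ, ∫ t in (0 : ℝ)..1,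
      F (ξ + (Pi.single i (t : UnitAddCircle) : UnitAddTorus (Fin d))) := by
  have hc : Continuous fun p : UnitAddTorus (Fin d) × ℝ =>
      F (p.1 + (Pi.single i (p.2 : UnitAddCircle) : UnitAddTorus (Fin d))) := by
    refine hF.comp (continuous_fst.add ?_)
    exact (continuous_single i).comp ((AddCircle.continuous_mk' 1).comp continuous_snd)
  let G : C(UnitAddTorus (Fin d), ℂ) := ⟨F, hF⟩
  simp only [intervalIntegral.integral_of_le zero_le_one]
  rw [integral_integral_swap]
  -- After the swap, translation invariance makes the inner integral independent of `t`.
  · have h : ∀ t : ℝ, ∫ ξ, F (ξ + (Pi.single i (t : UnitAddCircle) : UnitAddTorus (Fin d))) =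
        ∫ ξ, F ξ := fun t => integral_add_right_eq_self F _
    simp only [h]
    simp
  · exact Integrable.of_bound hc.aestronglyMeasurable ‖G‖
      (Filter.Eventually.of_forall fun p => G.norm_coe_le_norm _)

/-- Repeated integration by parts; the boundary terms cancel by periodicity. -/
theorem integral_fourier_mul_iteratedDeriv {s : ℕ} {h : ℝ → ℝ} (hh : ContDiff ℝ s h)
    (hper : Function.Periodic h 1) (m : ℤ) :
    ∫ t in (0 : ℝ)..1, fourier (-m) (t : UnitAddCircle) * ((iteratedDeriv s h t : ℝ) : ℂ) =
      (2 * Real.pi * Complex.I * m) ^ s *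
        ∫ t in (0 : ℝ)..1, fourier (-m) (t : UnitAddCircle) * (h t : ℂ) := by
  induction s with
  | zero => simp
  | succ s ih =>
    have hh' : ContDiff ℝ s h := hh.of_le (by exact_mod_cast s.le_succ)
    have hu : ∀ t : ℝ, HasDerivAt (fun t : ℝ => fourier (-m) (t : UnitAddCircle))
        (-2 * Real.pi * Complex.I * m / (1 : ℝ) * fourier (-m) (t : UnitAddCircle)) t :=
      fun t => hasDerivAt_fourier_neg 1 m t
    have hv : ∀ t : ℝ, HasDerivAt (fun t : ℝ => ((iteratedDeriv s h t : ℝ) : ℂ))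
        ((iteratedDeriv (s + 1) h t : ℝ) : ℂ) t := by
      intro t
      have := (hh.differentiable_iteratedDeriv' s t).hasDerivAt
      rw [← iteratedDeriv_succ] at this
      exact this.ofReal_comp
    have hfc : Continuous fun t : ℝ => fourier (-m) (t : UnitAddCircle) :=
      (fourier (-m)).continuous.comp (AddCircle.continuous_mk' 1)
    have hdc : Continuous fun t : ℝ => ((iteratedDeriv (s + 1) h t : ℝ) : ℂ) :=
      Complex.continuous_ofReal.comp (hh.continuous_iteratedDeriv' (s + 1))
    have hperD : iteratedDeriv s h 1 = iteratedDeriv s h 0 := by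
      have := iteratedDeriv_comp_add_const s h 1
      have h2 : (fun z => h (z + 1)) = h := funext hper
      rw [h2] at this
      simpa using (congrFun this 0).symm
    rw [intervalIntegral.integral_mul_deriv_eq_deriv_mul (fun t _ => hu t) (fun t _ => hv t)
      ((continuous_const.mul hfc).intervalIntegrable _ _) (hdc.intervalIntegrable _ _), hperD]
    have h1 : ((1 : ℝ) : UnitAddCircle) = 0 := AddCircle.coe_period 1
    have h0 : ((0 : ℝ) : UnitAddCircle) = 0 := rfl
    rw [pow_succ', mul_assoc _ (_ ^ s), ← ih hh', ← intervalIntegral.integral_const_mul, h1, h0, sub_self,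
      zero_sub, ← intervalIntegral.integral_neg]
    congr 1 with t
    push_cast
    ring

/-- Allows continuity on the torus to be checked on `ℝ^d`. -/
theorem isOpenQuotientMap_torus_coe (d : ℕ) :
    IsOpenQuotientMap (fun (y : Fin d → ℝ) (i : Fin d) => (y i : UnitAddCircle)) :=
  IsOpenQuotientMap.piMap fun _ : Fin d => QuotientAddGroup.isOpenQuotientMap_mk

theorem TorusContDiff.continuous {d s : ℕ} {g : UnitAddTorus (Fin d) → ℝ}
    (hg : TorusContDiff s g) : Continuous g :=
  (isOpenQuotientMap_torus_coe d).continuous_comp_iff.1 (ContDiff.continuous hg)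

theorem coe_add_smul_single {d : ℕ} (y : Fin d → ℝ) (i : Fin d) (t : ℝ) :
    (fun j => (((y + t • (Pi.single i (1 : ℝ) : Fin d → ℝ)) j : ℝ) : UnitAddCircle)) =
      (fun j => (y j : UnitAddCircle)) +
        (Pi.single i (t : UnitAddCircle) : UnitAddTorus (Fin d)) := by
  ext j
  rcases eq_or_ne j i with rfl | hj
  · simp
  · simp [Pi.single_eq_of_ne hj]

theorem TorusContDiff.contDiff_line {d s : ℕ} {g : UnitAddTorus (Fin d) → ℝ}
    (hg : TorusContDiff s g) (i : Fin d) (ξ : UnitAddTorus (Fin d)) :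
    ContDiff ℝ s fun t : ℝ =>
      g (ξ + (Pi.single i (t : UnitAddCircle) : UnitAddTorus (Fin d))) := by
  obtain ⟨y, rfl⟩ := (isOpenQuotientMap_torus_coe d).surjective ξ
  simp only [← coe_add_smul_single]
  exact ContDiff.comp (g := fun y : Fin d → ℝ => g fun j => (y j : UnitAddCircle))
    (f := fun t : ℝ => y + t • (Pi.single i (1 : ℝ) : Fin d → ℝ)) hg (by fun_prop)

/-- The line derivative is the full `s`-th derivative at `y` evaluated on copies of `e`, hence
continuous in `y`. -/
theorem continuous_iteratedDeriv_line {E : Type*} [NormedAddCommGroup E] [NormedSpace ℝ E] {s : ℕ}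
    {G : E → ℝ} (hG : ContDiff ℝ s G) (e : E) :
    Continuous fun y => iteratedDeriv s (fun t : ℝ => G (y + t • e)) 0 := by
  have h : ∀ y, iteratedDeriv s (fun t : ℝ => G (y + t • e)) 0 =
      iteratedFDeriv ℝ s G y fun _ => e := by
    intro y
    have hy : ContDiff ℝ s fun z => G (y + z) := hG.comp (by fun_prop)
    have := ContinuousLinearMap.iteratedFDeriv_comp_right
      ((ContinuousLinearMap.id ℝ ℝ).smulRight e) hy 0 (i := s) le_rfl
    rw [iteratedDeriv_eq_iteratedFDeriv]
    have h2 : (fun t : ℝ => G (y + t • e)) =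
        (fun z => G (y + z)) ∘ ((ContinuousLinearMap.id ℝ ℝ).smulRight e) := by
      ext t
      simp
    rw [h2, this, iteratedFDeriv_comp_add_left]
    simp
  simp only [h]
  have := hG.continuous_iteratedFDeriv (m := s) le_rfl
  fun_prop

theorem TorusContDiff.continuous_torusPartialDeriv {d s : ℕ} {g : UnitAddTorus (Fin d) → ℝ}
    (hg : TorusContDiff s g) (i : Fin d) : Continuous (torusPartialDeriv i s g) := by
  refine (isOpenQuotientMap_torus_coe d).continuous_comp_iff.1 ?_
  have := continuous_iteratedDeriv_line hg (Pi.single i (1 : ℝ) : Fin d → ℝ)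
  simp only [coe_add_smul_single] at this
  exact this

theorem torusFourierCoeff_torusPartialDeriv {d s : ℕ} {g : UnitAddTorus (Fin d) → ℝ}
    (hg : TorusContDiff s g) (i : Fin d) (k : Fin d → ℤ) :
    torusFourierCoeff (torusPartialDeriv i s g) k =
      (2 * Real.pi * Complex.I * k i) ^ s * torusFourierCoeff g k := by
  have hc := hg.continuous
  have hd := hg.continuous_torusPartialDeriv i
  rw [torusFourierCoeff, torusFourierCoeff,
    integral_torus_eq_integral_intervalIntegral (by fun_prop) i,
    integral_torus_eq_integral_intervalIntegral
      (F := fun ξ => UnitAddTorus.mFourier (-k) ξ * (g ξ : ℂ)) (by fun_prop) i,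
    ← integral_const_mul]
  congr 1 with ξ
  have hderiv : ∀ t : ℝ, torusPartialDeriv i s g
      (ξ + (Pi.single i (t : UnitAddCircle) : UnitAddTorus (Fin d))) =
      iteratedDeriv s (fun t : ℝ =>
        g (ξ + (Pi.single i (t : UnitAddCircle) : UnitAddTorus (Fin d)))) t := by
    intro t
    have := congrFun (iteratedDeriv_comp_const_add s (fun t : ℝ =>
        g (ξ + (Pi.single i (t : UnitAddCircle) : UnitAddTorus (Fin d)))) t) 0
    simp only [add_zero] at this
    rw [← this, torusPartialDeriv]
    congr 1 with u
    rw [add_assoc, ← Pi.single_add, AddCircle.coe_add]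
  have hper : Function.Periodic (fun t : ℝ =>
      g (ξ + (Pi.single i (t : UnitAddCircle) : UnitAddTorus (Fin d)))) 1 := by
    intro t
    simp only [AddCircle.coe_add_period]
  have key := integral_fourier_mul_iteratedDeriv (hg.contDiff_line i ξ) hper (k i)
  simp only [mFourier_add_arg, mFourier_single_arg, hderiv, mul_assoc, Pi.neg_apply,
    intervalIntegral.integral_const_mul] at key ⊢
  rw [key]
  ring

/-! ### Decay of the Fourier tail. -/

theorem torusL2Norm_nonneg {d : ℕ} (g : UnitAddTorus (Fin d) → ℝ) : 0 ≤ torusL2Norm g :=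
  Real.sqrt_nonneg _

/-- Bound `|k|_∞^(2s)` by `∑ |k_i|^(2s)` and apply Bessel to each pure derivative. -/
theorem TorusContDiff.sum_frequencyNorm_pow_mul_le {d s : ℕ} {g : UnitAddTorus (Fin d) → ℝ}
    (hg : TorusContDiff s g) (hs : s ≠ 0) (T : Finset (Fin d → ℤ)) :
    ∑ k ∈ T, (frequencyNorm k : ℝ) ^ (2 * s) * ‖torusFourierCoeff g k‖ ^ 2 ≤
      ((∑ i, torusL2Norm (torusPartialDeriv i s g)) / (2 * Real.pi) ^ s) ^ 2 := by
  have h1 : ∀ i k, |(k i : ℝ)| ^ (2 * s) * ‖torusFourierCoeff g k‖ ^ 2 =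
      ‖torusFourierCoeff (torusPartialDeriv i s g) k‖ ^ 2 / ((2 * Real.pi) ^ s) ^ 2 := by
    intro i k
    rw [torusFourierCoeff_torusPartialDeriv hg, norm_mul, norm_pow, norm_mul, norm_mul, norm_mul,
      Complex.norm_I, Complex.norm_intCast, Complex.norm_real, Complex.norm_ofNat,
      Real.norm_of_nonneg Real.pi_pos.le]
    have := Real.pi_pos
    simp only [mul_pow, ← pow_mul, mul_comm s 2]
    field_simp
    rw [one_pow, mul_one]
  calc _ ≤ ∑ k ∈ T, ∑ i, |(k i : ℝ)| ^ (2 * s) * ‖torusFourierCoeff g k‖ ^ 2 := by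
        gcongr with k
        rw [← Finset.sum_mul]
        gcongr
        exact frequencyNorm_pow_le k (by omega)
    _ = (∑ i, ∑ k ∈ T, ‖torusFourierCoeff (torusPartialDeriv i s g) k‖ ^ 2) /
          ((2 * Real.pi) ^ s) ^ 2 := by
        rw [Finset.sum_comm, Finset.sum_div]
        simp only [h1, Finset.sum_div]
    _ ≤ (∑ i, torusL2Norm (torusPartialDeriv i s g) ^ 2) / ((2 * Real.pi) ^ s) ^ 2 := by
        gcongr with i
        exact sum_le_hasSum T (fun _ _ => sq_nonneg _)
          (hasSum_sq_torusFourierCoeff (hg.continuous_torusPartialDeriv i))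
    _ ≤ _ := by
        rw [div_pow]
        gcongr
        exact Finset.sum_sq_le_sq_sum_of_nonneg fun i _ => torusL2Norm_nonneg _

theorem TorusContDiff.sq_sum_norm_torusFourierCoeff_le {d s : ℕ} {g : UnitAddTorus (Fin d) → ℝ}
    (hg : TorusContDiff s g) (hs : s ≠ 0) {T : Finset (Fin d → ℤ)}
    (hT : ∀ k ∈ T, frequencyNorm k ≠ 0) :
    (∑ k ∈ T, ‖torusFourierCoeff g k‖) ^ 2 ≤
      (∑ k ∈ T, ((frequencyNorm k : ℝ) ^ (2 * s))⁻¹) *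
        ((∑ i, torusL2Norm (torusPartialDeriv i s g)) / (2 * Real.pi) ^ s) ^ 2 := by
  have h := Finset.sum_mul_sq_le_sq_mul_sq T (fun k => ((frequencyNorm k : ℝ) ^ s)⁻¹)
    fun k => (frequencyNorm k : ℝ) ^ s * ‖torusFourierCoeff g k‖
  rw [Finset.sum_congr rfl (g := fun k => ‖torusFourierCoeff g k‖)] at h
  · simp only [inv_pow, mul_pow, ← pow_mul, mul_comm s 2] at h
    refine h.trans ?_
    gcongr
    exact hg.sum_frequencyNorm_pow_mul_le hs T
  · intro k hk
    have : (frequencyNorm k : ℝ) ≠ 0 := by exact_mod_cast hT k hk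
    field_simp

theorem sq_le_cutoffFrequency_pow {d s p : ℕ} (hp : 1 ≤ p) (hps : 2 * s = d + p) {C ε : ℝ}
    (hC : 0 ≤ C) (hε : 0 < ε) :
    (12 * Real.sqrt 2 * C * 2 ^ d / ((2 * Real.pi) ^ s * ε)) ^ 2 ≤
      (cutoffFrequency d s C ε : ℝ) ^ p := by
  set A := 12 * Real.sqrt 2 * C * 2 ^ d / ((2 * Real.pi) ^ s * ε) with hA
  have hA0 : 0 ≤ A := by
    have := Real.pi_pos
    positivity
  have hexp : 2 * (s : ℝ) - d = p := by
    have : (2 * s : ℝ) = d + p := by exact_mod_cast hps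
    linarith
  have hp0 : (p : ℝ) ≠ 0 := by positivity
  calc A ^ 2 = (A ^ (2 / (p : ℝ))) ^ p := by
        rw [← Real.rpow_natCast (A ^ (2 / (p : ℝ))), ← Real.rpow_mul hA0, div_mul_cancel₀ _ hp0]
        norm_num
    _ ≤ _ := by
        gcongr
        rw [cutoffFrequency, ← hA, hexp]
        exact Nat.le_ceil _

theorem cutoffFrequency_zero {d s : ℕ} (hs : (d : ℝ) / 2 < s) (ε : ℝ) :
    cutoffFrequency d s 0 ε = 0 := by
  rw [cutoffFrequency]
  have : 2 / (2 * (s : ℝ) - d) ≠ 0 := by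
    have : 0 < 2 * (s : ℝ) - d := by linarith
    positivity
  simp [Real.zero_rpow this]

theorem cutoffFrequency_pos (d s : ℕ) {C ε : ℝ} (hC : 0 < C) (hε : 0 < ε) :
    0 < cutoffFrequency d s C ε := by
  have := Real.pi_pos
  exact Nat.ceil_pos.2 (by positivity)

/-- The `ℓ¹` norm of the Fourier coefficients beyond the cut-off frequency. -/
theorem TorusContDiff.sum_norm_torusFourierCoeff_le {d s : ℕ} {g : UnitAddTorus (Fin d) → ℝ}
    (hg : TorusContDiff s g) (hs : (d : ℝ) / 2 < s) {C ε : ℝ} (hC : 0 ≤ C) (hε : 0 < ε)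
    (hgC : ∑ i, torusL2Norm (torusPartialDeriv i s g) ≤ C) {T : Finset (Fin d → ℤ)}
    (hT : ∀ k ∈ T, k ∉ frequencyCube d (cutoffFrequency d s C ε)) :
    ∑ k ∈ T, ‖torusFourierCoeff g k‖ ≤ if C = 0 then 0 else ε / 12 := by
  have hpi := Real.pi_pos
  have hds : d < 2 * s := by
    have : (d : ℝ) < 2 * s := by linarith
    exact_mod_cast this
  obtain ⟨p, hps⟩ := Nat.exists_eq_add_of_lt hds
  set N := cutoffFrequency d s C ε
  have hT0 : ∀ k ∈ T, frequencyNorm k ≠ 0 := by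
    intro k hk h0
    exact hT k hk (mem_frequencyCube.2 (by omega))
  have hS : 0 ≤ ∑ i, torusL2Norm (torusPartialDeriv i s g) :=
    Finset.sum_nonneg fun i _ => torusL2Norm_nonneg _
  have key := hg.sq_sum_norm_torusFourierCoeff_le (by omega) hT0
  split_ifs with hC0
  · rw [le_antisymm (hgC.trans_eq hC0) hS] at key
    simp only [zero_div, ne_eq, OfNat.ofNat_ne_zero, not_false_eq_true, zero_pow, mul_zero] at key
    exact (pow_eq_zero_iff two_ne_zero).1 (le_antisymm key (sq_nonneg _)) |>.le
  have hCpos : 0 < C := lt_of_le_of_ne hC (Ne.symm hC0)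
  have hA := sq_le_cutoffFrequency_pow (p := p + 1) (by omega) (by omega) hC hε (s := s) (d := d)
  set A := 12 * Real.sqrt 2 * C * 2 ^ d / ((2 * Real.pi) ^ s * ε) with hAdef
  have hApos : 0 < A := by positivity
  have hN : 1 ≤ N := cutoffFrequency_pos d s hCpos hε
  have hTM : T ⊆ frequencyCube d (max N (T.sup frequencyNorm)) \ frequencyCube d N := by
    intro k hk
    rw [Finset.mem_sdiff, mem_frequencyCube]
    exact ⟨(Finset.le_sup (f := frequencyNorm) hk).trans (le_max_right _ _), hT k hk⟩
  have hW : ∑ k ∈ T, ((frequencyNorm k : ℝ) ^ (2 * s))⁻¹ ≤ 2 * 4 ^ d / A ^ 2 := by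
    calc _ ≤ _ := Finset.sum_le_sum_of_subset_of_nonneg hTM fun _ _ _ => by positivity
      _ ≤ _ := sum_frequencyNorm_pow_inv_le hN (le_max_left _ _) (p := p + 1) (by omega)
        (by omega)
      _ ≤ 2 * 4 ^ d * (1 / (N : ℝ) ^ (p + 1)) := by
        gcongr
        exact sub_le_self _ (by positivity)
      _ ≤ 2 * 4 ^ d * (1 / A ^ 2) := by gcongr
      _ = _ := by ring
  refine le_of_sq_le_sq ?_ (by positivity)
  calc _ ≤ _ := key
    _ ≤ 2 * 4 ^ d / A ^ 2 * (C / (2 * Real.pi) ^ s) ^ 2 := by gcongr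
    -- The constant `12 √2 · 2^d` in the cut-off is chosen for this: its square is `144 · 2 · 4^d`.
    _ = (ε / 12) ^ 2 := by
      have h4 : (4 : ℝ) ^ d = (2 ^ d) ^ 2 := by
        rw [← pow_mul, mul_comm d 2, pow_mul]
        norm_num
      rw [hAdef, h4]
      simp only [div_pow, mul_pow, Real.sq_sqrt (zero_le_two : (0 : ℝ) ≤ 2)]
      field_simp

/-- The uniform bound on finite tails forces absolute summability, so the Fourier series converges
pointwise to `g` and the bound passes to the limit. -/
theorem norm_sub_sum_torusFourierCoeff_le {d : ℕ} {g : UnitAddTorus (Fin d) → ℝ}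
    (hg : Continuous g) (Q : Finset (Fin d → ℤ)) {τ : ℝ}
    (h : ∀ T : Finset (Fin d → ℤ), (∀ k ∈ T, k ∉ Q) → ∑ k ∈ T, ‖torusFourierCoeff g k‖ ≤ τ)
    (ξ : UnitAddTorus (Fin d)) :
    ‖(g ξ : ℂ) - ∑ k ∈ Q, torusFourierCoeff g k * UnitAddTorus.mFourier k ξ‖ ≤ τ := by
  have hsum : Summable fun k => ‖torusFourierCoeff g k‖ := by
    refine summable_of_sum_le (c := ∑ k ∈ Q, ‖torusFourierCoeff g k‖ + τ)
      (fun _ => norm_nonneg _) fun T => ?_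
    rw [← Finset.sum_inter_add_sum_sdiff T Q]
    gcongr
    · exact Finset.inter_subset_right
    · exact h _ fun k hk => (Finset.mem_sdiff.1 hk).2
  have hlim := (hasSum_torusFourierCoeff_mul hg hsum ξ).sub_const
    (∑ k ∈ Q, torusFourierCoeff g k * UnitAddTorus.mFourier k ξ)
  refine le_of_tendsto hlim.norm ?_
  filter_upwards [Filter.eventually_ge_atTop Q] with T hT
  rw [← Finset.sum_sdiff hT, add_sub_cancel_right]
  refine (norm_sum_le_of_le _ fun k _ => ?_).trans
    (h (T \ Q) fun k hk => (Finset.mem_sdiff.1 hk).2)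
  rw [norm_mul]
  refine mul_le_of_le_one_right (norm_nonneg _) ?_
  exact ((UnitAddTorus.mFourier k).norm_coe_le_norm ξ).trans_eq UnitAddTorus.mFourier_norm

/-! ### Real coordinates for the low frequencies. -/

/-- The vector of real (Hartley) coefficients `Re c_k + Im c_k` with `|k|_∞ ≤ N`. -/
noncomputable def hartleyVector {d : ℕ} (N : ℕ) (g : UnitAddTorus (Fin d) → ℝ) :
    EuclideanSpace ℝ (frequencyCube d N) :=
  WithLp.toLp 2 fun k => (torusFourierCoeff g k).re + (torusFourierCoeff g k).im

/-- Since `g` is real, `c_{-k}` is the conjugate of `c_k`; the cross terms `Re c_k · Im c_k` are odd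
in `k` and cancel over the symmetric cube. -/
theorem norm_sq_hartleyVector {d : ℕ} (N : ℕ) (g : UnitAddTorus (Fin d) → ℝ) :
    ‖hartleyVector N g‖ ^ 2 = ∑ k ∈ frequencyCube d N, ‖torusFourierCoeff g k‖ ^ 2 := by
  have hodd : ∑ k ∈ frequencyCube d N, (torusFourierCoeff g k).re * (torusFourierCoeff g k).im =
      -∑ k ∈ frequencyCube d N, (torusFourierCoeff g k).re * (torusFourierCoeff g k).im := by
    rw [← Finset.sum_neg_distrib]
    refine Finset.sum_nbij' (fun k => -k) (fun k => -k) (fun k hk => neg_mem_frequencyCube hk)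
      (fun k hk => neg_mem_frequencyCube hk) (fun k _ => neg_neg k) (fun k _ => neg_neg k) ?_
    intro k _
    rw [torusFourierCoeff_neg]
    simp
  rw [EuclideanSpace.norm_sq_eq]
  simp only [hartleyVector, Real.norm_eq_abs, sq_abs]
  rw [Finset.sum_coe_sort (frequencyCube d N)
    fun k => ((torusFourierCoeff g k).re + (torusFourierCoeff g k).im) ^ 2]
  have hsq : ∀ k, ((torusFourierCoeff g k).re + (torusFourierCoeff g k).im) ^ 2 =
      ‖torusFourierCoeff g k‖ ^ 2 +
        2 * ((torusFourierCoeff g k).re * (torusFourierCoeff g k).im) := by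
    intro k
    rw [← Complex.normSq_eq_norm_sq, Complex.normSq_apply]
    ring
  simp only [hsq, Finset.sum_add_distrib, ← Finset.mul_sum]
  linarith

theorem norm_hartleyVector_le {d : ℕ} (N : ℕ) {g : UnitAddTorus (Fin d) → ℝ}
    (hg : Continuous g) : ‖hartleyVector N g‖ ≤ torusL2Norm g := by
  refine le_of_sq_le_sq ?_ (torusL2Norm_nonneg g)
  rw [norm_sq_hartleyVector]
  exact sum_le_hasSum _ (fun _ _ => sq_nonneg _) (hasSum_sq_torusFourierCoeff hg)

theorem hartleyVector_sub {d : ℕ} (N : ℕ) {g h : UnitAddTorus (Fin d) → ℝ}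
    (hg : Continuous g) (hh : Continuous h) :
    hartleyVector N (g - h) = hartleyVector N g - hartleyVector N h := by
  ext k
  simp only [hartleyVector, torusFourierCoeff_sub hg hh, PiLp.sub_apply, Complex.sub_re,
    Complex.sub_im]
  ring

theorem sum_norm_torusFourierCoeff_le_sqrt_mul {d : ℕ} (N : ℕ) (g : UnitAddTorus (Fin d) → ℝ) :
    ∑ k ∈ frequencyCube d N, ‖torusFourierCoeff g k‖ ≤
      Real.sqrt (frequencyCube d N).card * ‖hartleyVector N g‖ := by
  refine le_of_sq_le_sq ?_ (by positivity)
  rw [mul_pow, Real.sq_sqrt (Nat.cast_nonneg _), norm_sq_hartleyVector]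
  exact sq_sum_le_card_mul_sum_sq

/-- Two continuous functions with small Fourier tails are uniformly close when their Hartley
vectors are close. -/
theorem abs_sub_le_of_hartleyVector {d N : ℕ} {g h : UnitAddTorus (Fin d) → ℝ}
    (hg : Continuous g) (hh : Continuous h) {τ : ℝ}
    (hgτ : ∀ T : Finset (Fin d → ℤ), (∀ k ∈ T, k ∉ frequencyCube d N) →
      ∑ k ∈ T, ‖torusFourierCoeff g k‖ ≤ τ)
    (hhτ : ∀ T : Finset (Fin d → ℤ), (∀ k ∈ T, k ∉ frequencyCube d N) →
      ∑ k ∈ T, ‖torusFourierCoeff h k‖ ≤ τ) (ξ : UnitAddTorus (Fin d)) :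
    |g ξ - h ξ| ≤ 2 * τ +
      Real.sqrt (frequencyCube d N).card * ‖hartleyVector N g - hartleyVector N h‖ := by
  rw [← hartleyVector_sub N hg hh]
  have hsub : ∀ T : Finset (Fin d → ℤ), (∀ k ∈ T, k ∉ frequencyCube d N) →
      ∑ k ∈ T, ‖torusFourierCoeff (g - h) k‖ ≤ 2 * τ := by
    intro T hT
    calc _ ≤ ∑ k ∈ T, (‖torusFourierCoeff g k‖ + ‖torusFourierCoeff h k‖) := by
          gcongr with k
          rw [torusFourierCoeff_sub hg hh]
          exact norm_sub_le _ _
      _ ≤ _ := by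
          rw [Finset.sum_add_distrib]
          linarith [hgτ T hT, hhτ T hT]
  have h1 := norm_sub_sum_torusFourierCoeff_le (hg.sub hh) (frequencyCube d N) hsub ξ
  have h2 : ‖∑ k ∈ frequencyCube d N,
      torusFourierCoeff (g - h) k * UnitAddTorus.mFourier k ξ‖ ≤
      ∑ k ∈ frequencyCube d N, ‖torusFourierCoeff (g - h) k‖ := by
    refine norm_sum_le_of_le _ fun k _ => ?_
    rw [norm_mul]
    refine mul_le_of_le_one_right (norm_nonneg _) ?_
    exact ((UnitAddTorus.mFourier k).norm_coe_le_norm ξ).trans_eq UnitAddTorus.mFourier_norm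
  have h3 := sum_norm_torusFourierCoeff_le_sqrt_mul N (g - h)
  have h4 : |g ξ - h ξ| = ‖(((g - h) ξ : ℝ) : ℂ)‖ := by
    rw [Complex.norm_real, Real.norm_eq_abs, Pi.sub_apply]
  rw [h4]
  have h5 := norm_le_norm_sub_add (((g - h) ξ : ℝ) : ℂ)
    (∑ k ∈ frequencyCube d N, torusFourierCoeff (g - h) k * UnitAddTorus.mFourier k ξ)
  linarith

/-! ### From separated sets to the covering number. -/

theorem coveringNumber_le_ofReal {Y : Type*} [PseudoMetricSpace Y] {A : Set Y} {r b : ℝ}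
    (hr : 0 < r) (hb : 0 ≤ b)
    (h : ∀ P : Finset Y, (P : Set Y) ⊆ A →
      (∀ x ∈ P, ∀ y ∈ P, x ≠ y → r < dist x y) → (P.card : ℝ) ≤ b) :
    ((Metric.coveringNumber r.toNNReal A : ℕ∞) : ℝ≥0∞) ≤ ENNReal.ofReal b := by
  have hN : Metric.coveringNumber r.toNNReal A ≤ (⌊b⌋₊ : ℕ∞) := by
    refine (Metric.coveringNumber_le_packingNumber _ _).trans ?_
    refine iSup₂_le fun P hPA => iSup_le fun hP => ?_
    by_contra! hlt
    -- A too large, possibly infinite, packing contains a finite one of size `⌊b⌋₊ + 1`, to which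
    -- `h` applies.
    obtain ⟨Q, hQP, hQ⟩ := Set.exists_subset_encard_eq (Order.add_one_le_of_lt hlt)
    have hfin : Q.Finite := Set.finite_of_encard_eq_coe (k := ⌊b⌋₊ + 1) (by rw [hQ]; rfl)
    have hcard := h hfin.toFinset (by simpa using hQP.trans hPA) (by
      intro x hx y hy hxy
      have : (r.toNNReal : ℝ≥0∞) < edist x y := hP (hQP (hfin.mem_toFinset.1 hx)) (hQP (hfin.mem_toFinset.1 hy)) hxy
      rwa [edist_dist, ← ENNReal.ofReal, ENNReal.ofReal_lt_ofReal_iff_of_nonneg hr.le] at this)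
    rw [hfin.encard_eq_coe_toFinset_card] at hQ
    have hQ' : hfin.toFinset.card = ⌊b⌋₊ + 1 := by exact_mod_cast hQ
    rw [hQ'] at hcard
    push_cast at hcard
    linarith [Nat.lt_floor_add_one b]
  calc _ ≤ (((⌊b⌋₊ : ℕ∞)) : ℝ≥0∞) := by exact_mod_cast hN
    _ = ENNReal.ofReal (⌊b⌋₊ : ℝ) := by simp
    _ ≤ _ := ENNReal.ofReal_le_ofReal (Nat.floor_le hb)

theorem lemma3p5 (n d : ℕ) (X : Set (EuclideanSpace ℝ (Fin n))) (hX : X.Nonempty)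
    (f : X → UnitAddTorus (Fin d) → ℝ)
    (s : ℕ) (hs : (d : ℝ) / 2 < s)
    (hf : ∀ x : X, TorusContDiff s (f x))
    (B : ℝ) (hB : IsLUB (range fun x : X => torusL2Norm (f x)) B)
    (C : ℝ) (hC : IsLUB
      (range fun x : X => ∑ i : Fin d, torusL2Norm (torusPartialDeriv i s (f x))) C)
    (ε : ℝ) (hε : 0 < ε) :
    ((Metric.coveringNumber (ε / 4).toNNReal (functionFamily f) : ℕ∞) : ℝ≥0∞) ≤
      ENNReal.ofReal (max 1
        (1 / (frequencyCount d s C ε : ℝ)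
          * (Real.pi * (frequencyCount d s C ε : ℝ) ^ 2 / 2) ^ frequencyCount d s C ε
          * (24 * B / ε) ^ (2 * frequencyCount d s C ε))) := by
  obtain ⟨x₀, hx₀⟩ := hX
  have hfB : ∀ x, torusL2Norm (f x) ≤ B := fun x => hB.1 (mem_range_self x)
  have hfC : ∀ x, ∑ i, torusL2Norm (torusPartialDeriv i s (f x)) ≤ C :=
    fun x => hC.1 (mem_range_self x)
  have hB0 : 0 ≤ B := (torusL2Norm_nonneg _).trans (hfB ⟨x₀, hx₀⟩)
  have hC0 : 0 ≤ C :=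
    (Finset.sum_nonneg fun i _ => torusL2Norm_nonneg _).trans (hfC ⟨x₀, hx₀⟩)
  refine coveringNumber_le_ofReal (by positivity) (by positivity) fun P hPF hP => ?_
  rcases le_or_gt P.card 1 with hcard | hcard
  · exact le_max_of_le_left (by exact_mod_cast hcard)
  refine le_max_of_le_right ?_
  set N := cutoffFrequency d s C ε with hN
  -- For `C = 0` and `y = 24 B / ε`, the tail `ε/12` would give `1 + y` with only `y ≥ 1` known, too
  -- weak against `π y² / 2`; a zero tail gives `1 + y/3` with `y ≥ 3`.
  set τ : ℝ := if C = 0 then 0 else ε / 12 with hτ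
  have hD : (frequencyCube d N).card = frequencyCount d s C ε := card_frequencyCube d N
  set D := frequencyCount d s C ε with hDdef
  have hDpos : 0 < D := by
    rw [hDdef, frequencyCount]
    positivity
  have hqpos : 0 < Real.sqrt D := Real.sqrt_pos.2 (by exact_mod_cast hDpos)
  have hτε : 2 * τ < ε / 4 := by
    rw [hτ]
    split_ifs <;> linarith
  set r : ℝ := (ε / 4 - 2 * τ) / Real.sqrt D with hr
  have hrpos : 0 < r := div_pos (by linarith) hqpos
  have hsep : ∀ g ∈ P, ∀ h ∈ P, g ≠ h → r ≤ ‖hartleyVector N g - hartleyVector N h‖ := by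
    intro g hg h hh hgh
    obtain ⟨x, hx⟩ := hPF hg
    obtain ⟨y, hy⟩ := hPF hh
    have hdist := hP g hg h hh hgh
    by_contra! hlt
    refine hdist.not_ge ((ContinuousMap.dist_le (by positivity)).2 fun ξ => ?_)
    rw [Real.dist_eq]
    refine (abs_sub_le_of_hartleyVector (N := N) g.continuous h.continuous (τ := τ) ?_ ?_
      ξ).trans ?_
    · rw [hx]
      exact fun T hT => (hf x).sum_norm_torusFourierCoeff_le hs hC0 hε (hfC x) hT
    · rw [hy]
      exact fun T hT => (hf y).sum_norm_torusFourierCoeff_le hs hC0 hε (hfC y) hT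
    · rw [hD]
      rw [hr, lt_div_iff₀ hqpos] at hlt
      linarith
  have hnorm : ∀ g ∈ P, ‖hartleyVector N g‖ ≤ B := by
    intro g hg
    obtain ⟨x, hx⟩ := hPF hg
    refine (norm_hartleyVector_le N g.continuous).trans ?_
    rw [hx]
    exact hfB x
  classical
  have hinj : Set.InjOn (fun g : C(UnitAddTorus (Fin d), ℝ) => hartleyVector N g) P := by
    intro g hg h hh hgh
    by_contra hne
    have := hsep g hg h hh hne
    simp only at hgh
    rw [hgh, sub_self, norm_zero] at this
    linarith
  have hpack : (P.card : ℝ) ≤ (1 + 2 * B / r) ^ D := by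
    have := card_le_of_pairwise_le_norm_sub
      (P.image fun g : C(UnitAddTorus (Fin d), ℝ) => hartleyVector N g) hB0 hrpos
      (by simpa using hnorm) (by
        simp only [Finset.mem_image]
        rintro _ ⟨g, hg, rfl⟩ _ ⟨h, hh, rfl⟩ hne
        exact hsep g hg h hh fun e => hne (by rw [e]))
    rwa [Finset.card_image_of_injOn hinj, finrank_euclideanSpace, Fintype.card_coe, hD] at this
  -- Two distinct points in the ball of radius `B`; this supplies the lower bound on `24 B / ε`
  -- needed in both comparisons.
  have hrB : r ≤ 2 * B := by
    obtain ⟨g, hg, h, hh, hne⟩ := Finset.one_lt_card.1 hcard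
    linarith [hsep g hg h hh hne, norm_sub_le (hartleyVector N g) (hartleyVector N h),
      hnorm g hg, hnorm h hh]
  refine hpack.trans ?_
  by_cases hCz : C = 0
  · have hD1 : D = 1 := by
      rw [hDdef, frequencyCount, hCz, cutoffFrequency_zero hs]
      simp
    rw [hr, hτ, if_pos hCz, hD1] at hrB ⊢
    simp only [Nat.cast_one, Real.sqrt_one, mul_zero, sub_zero, div_one] at hrB ⊢
    have hy : 3 ≤ 24 * B / ε := by
      rw [le_div_iff₀ hε]
      linarith
    have := one_add_div_le_pi_mul_sq hy
    calc _ = 1 + 24 * B / ε / 3 := by field_simp; ring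
      _ ≤ _ := this
      _ = _ := by ring
  · have hpos : 0 < C := lt_of_le_of_ne hC0 (Ne.symm hCz)
    have hrval : 2 * B / r = 24 * B / ε * Real.sqrt D := by
      rw [hr, hτ, if_neg hCz]
      field_simp
      ring
    -- For `d = 0` the sum of derivative norms is empty, so its supremum `C` would not be positive.
    have hd : d ≠ 0 := by
      rintro rfl
      refine hpos.not_ge (hC.2 ?_)
      rintro _ ⟨x, rfl⟩
      simp
    have hD2 : 2 ≤ D := by
      have hNpos : 0 < N := cutoffFrequency_pos d s hpos hε
      calc 2 ≤ 2 * N + 1 := by omega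
        _ ≤ (2 * N + 1) ^ d := Nat.le_self_pow hd _
    rw [hrval]
    refine one_add_mul_sqrt_pow_le hD2 ?_
    rw [← hrval, le_div_iff₀ hrpos]
    linarith
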